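/- Let $K$ be an algebraically closed field. For $n\ge 1$ let $T_n$ be the set of upper triangular and $U_n\subset T_n$ the set of strictly upper triangular $n\times n$ matrices over $K$, and let $$CT_n=\{(X,Y)\in T_n\times T_n : [X,Y]=0\},\qquad NT_n=CT_n\cap(U_n\times U_n).$$ A matrix in $T_n$ is called regular if its minimal polynomial has degree $n$; let $CT_n^0$ be the Zariski closure of the set of all $(X,Y)\in CT_n$ with $X$ and $Y$ both regular. For a partition $J=\{J_1,\dots,J_s\}$ of $\{1,\dots,n\}$ into consecutive intervals let $U_n^J$ be the set of all $X=(x_{i,j})\in U_n$ with $x_{i,j}=0$ whenever $i$ and $j$ lie in the same $J_h$, and let $NT_n^J=NT_n\cap(U_n^J\times U_n^J)$. The group $K^2$ acts on $CT_n$ by $(x,y)\cdot(X,Y)=(X+xI_n,Y+yI_n)$. Dimension and irreducibility refer to the Zariski topology on pairs of matrices. Let $n=17$ and let $J_1,\dots,J_5$ be the consecutive intervals with $|J_1|=2$, $|J_2|=4$, $|J_3|=5$, $|J_4|=4$, $|J_5|=2$. Then: 1. $\dim (U_{17}^J\times U_{17}^J)=224$; inside $U_{17}^J\times U_{17}^J$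 the variety $NT_{17}^J$ is defined by the vanishing of the entries of $[X,Y]$ of indices $(i,j)$ with $i\in J_h$, $j\in J_k$, $h+2\le k$, and there are exactly $56$ such $(i,j)$; and $\dim NT_{17}^J\ge 168$. 2. The orbit $K^2\cdot NT_{17}^J$ has dimension at least $170$, while $\dim CT_{17}^0=170$. 3. The orbit $K^2\cdot NT_{17}^J$ is contained in $CT_{17}$, and neither $X$ nor $Y$ is regular for any $(X,Y)$ in it. 4. $CT_{17}$ is reducible. Moreover there is a natural number $m'<17$ such that, for every $n\ge 1$, $CT_n$ is reducible if and only if $n>m'$. -/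

import Mathlib

/-- The Zariski topology on the affine space `σ → K`: the closed sets are the common zero loci
of ideals of polynomials. -/
@[reducible] def zariskiTopology (σ K : Type*) [Field K] : TopologicalSpace (σ → K) :=
  TopologicalSpace.ofClosed
    {Z | ∃ I : Ideal (MvPolynomial σ K), Z = MvPolynomial.zeroLocus K I}
    ⟨⊤, (MvPolynomial.zeroLocus_top (k := K) (K := K) (σ := σ)).symm⟩
    (by
      intro A hA
      refine ⟨⨆ I ∈ {I : Ideal (MvPolynomial σ K) | MvPolynomial.zeroLocus K I ∈ A}, I, ?_⟩
      apply Set.Subset.antisymm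
      · intro x hx
        change x ∈ (MvPolynomial.zeroLocus K _ : Set (σ → K))
        apply (MvPolynomial.le_zeroLocus_iff_le_vanishingIdeal (V := {x})).mpr ?_ rfl
        refine iSup₂_le fun I hI => ?_
        apply MvPolynomial.le_zeroLocus_iff_le_vanishingIdeal.mp
        intro y hy
        rw [Set.mem_singleton_iff.mp hy]
        exact hx _ hI
      · intro x hx Z hZ
        obtain ⟨I, rfl⟩ := hA hZ
        exact MvPolynomial.zeroLocus_anti_mono (le_iSup₂_of_le I hZ le_rfl) hx)
    (by
      rintro _ ⟨I, rfl⟩ _ ⟨J, rfl⟩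
      refine ⟨I * J, ?_⟩
      apply Set.Subset.antisymm
      · rintro x (hx | hx)
        · exact MvPolynomial.zeroLocus_anti_mono Ideal.mul_le_left hx
        · exact MvPolynomial.zeroLocus_anti_mono Ideal.mul_le_right hx
      · intro x hx
        by_contra h
        rw [Set.mem_union, not_or] at h
        obtain ⟨h1, h2⟩ := h
        rw [MvPolynomial.mem_zeroLocus_iff] at h1 h2
        push Not at h1 h2
        obtain ⟨p, hp, hp0⟩ := h1
        obtain ⟨q, hq, hq0⟩ := h2
        have := MvPolynomial.mem_zeroLocus_iff.mp hx (p * q) (Ideal.mul_mem_mul hp hq)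
        rw [map_mul] at this
        exact (mul_ne_zero hp0 hq0) this)

/-- Pairs of `n × n` matrices over `K`. -/
abbrev MatPair (K : Type*) (n : ℕ) : Type _ :=
  Matrix (Fin n) (Fin n) K × Matrix (Fin n) (Fin n) K

/-- The `2n²` coordinates of a pair of matrices; this identifies `MatPair K n` with an
affine space. -/
def pairCoords (K : Type*) (n : ℕ) (p : MatPair K n) :
    (Fin n × Fin n) ⊕ (Fin n × Fin n) → K :=
  Sum.elim (fun ij => p.1 ij.1 ij.2) (fun ij => p.2 ij.1 ij.2)

/-- The Zariski topology on the affine space of pairs of matrices (it is not the product of the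
Zariski topologies of the two factors). -/
@[reducible] def pairZariski (K : Type*) [Field K] (n : ℕ) : TopologicalSpace (MatPair K n) :=
  (zariskiTopology ((Fin n × Fin n) ⊕ (Fin n × Fin n)) K).induced (pairCoords K n)

/-- The dimension of a set of pairs of matrices: its Krull dimension as a topological space, for
the topology induced by the Zariski topology. -/
noncomputable def zariskiDim (K : Type*) [Field K] (n : ℕ) (S : Set (MatPair K n)) :
    WithBot ℕ∞ :=
  letI : TopologicalSpace (MatPair K n) := pairZariski K n
  topologicalKrullDim S

/-- Irreducibility of a set of pairs of matrices in the Zariski topology. -/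
def ZariskiIrreducible (K : Type*) [Field K] (n : ℕ) (S : Set (MatPair K n)) : Prop :=
  @IsIrreducible (MatPair K n) (pairZariski K n) S

/-- Closure of a set of pairs of matrices in the Zariski topology. -/
def zariskiClosure (K : Type*) [Field K] (n : ℕ) (S : Set (MatPair K n)) :
    Set (MatPair K n) :=
  @closure (MatPair K n) (pairZariski K n) S

/-- Upper triangular matrices. -/
def upperTri (K : Type*) [Field K] (n : ℕ) : Set (Matrix (Fin n) (Fin n) K) :=
  {X | ∀ i j, j < i → X i j = 0}

/-- Strictly upper triangular matrices. -/
def strictUpperTri (K : Type*) [Field K] (n : ℕ) : Set (Matrix (Fin n) (Fin n) K) :=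
  {X | ∀ i j, j ≤ i → X i j = 0}

/-- The variety of commuting pairs of upper triangular matrices. -/
def CT (K : Type*) [Field K] (n : ℕ) : Set (MatPair K n) :=
  {p | p.1 ∈ upperTri K n ∧ p.2 ∈ upperTri K n ∧ ⁅p.1, p.2⁆ = 0}

/-- The variety of commuting pairs of strictly upper triangular matrices. -/
def NT (K : Type*) [Field K] (n : ℕ) : Set (MatPair K n) :=
  CT K n ∩ strictUpperTri K n ×ˢ strictUpperTri K n

/-- A matrix is regular if its minimal polynomial has degree `n`. -/
def IsRegularMatrix (K : Type*) [Field K] (n : ℕ) (X : Matrix (Fin n) (Fin n) K) : Prop :=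
  (minpoly K X).natDegree = n

/-- The Zariski closure of the set of pairs in `CT K n` both of whose entries are regular. -/
def CT0 (K : Type*) [Field K] (n : ℕ) : Set (MatPair K n) :=
  zariskiClosure K n {p ∈ CT K n | IsRegularMatrix K n p.1 ∧ IsRegularMatrix K n p.2}

/-- For a partition `J` of the index set into consecutive intervals (a composition of `n`), the
strictly upper triangular matrices whose `(i, j)` entry vanishes whenever `i` and `j` lie in the
same interval of `J`. -/
def UJ (K : Type*) [Field K] {n : ℕ} (J : Composition n) : Set (Matrix (Fin n) (Fin n) K) :=
  {X ∈ strictUpperTri K n | ∀ i j, J.index i = J.index j → X i j = 0}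

/-- The commuting pairs of strictly upper triangular matrices both of which lie in `UJ K J`. -/
def NTJ (K : Type*) [Field K] {n : ℕ} (J : Composition n) : Set (MatPair K n) :=
  NT K n ∩ UJ K J ×ˢ UJ K J

/-- The orbit of a set of pairs under the action `(x, y) • (X, Y) = (X + x I, Y + y I)` of `K²`. -/
def translationOrbit (K : Type*) [Field K] (n : ℕ) (S : Set (MatPair K n)) :
    Set (MatPair K n) :=
  {q | ∃ p ∈ S, ∃ x y : K, q = (p.1 + x • 1, p.2 + y • 1)}

/-! The proof is a dimension count. Strict block matrices for the sizes 2, 4, 5, 4, 2 form a space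
of dimension 112. In a commutator of two of them, only entries at least two blocks above the
diagonal can be nonzero, so commuting costs just 56 equations on pairs. This leaves dimension at
least 168, and 170 once the two scalars are added. On the other side, a regular X commutes only with
polynomials in X, so `CT0` is parametrized by the 153 entries of X and 17 coefficients, and has
dimension at most 170.

If `CT` were irreducible, the open condition of having distinct diagonal entries would be dense in
it, so `CT` would lie in `CT0`. But the translation orbit contains a chain of irreducible closed
sets of length at least 170 and misses the pairs with distinct diagonal entries. Putting `CT` on top
of that chain gives length at least 171 inside `CT0`, a contradiction (`succ_le_zariskiDim_CT0`).

Lower bounds come from Krull's height theorem (`exists_ltSeries_primeSpectrum_of_mem`), upper bounds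
from dense polynomial parametrizations (`topologicalKrullDim_le_card`). The threshold exists because
`CT` for size n is a continuous image of `CT` for size n + 1. -/

/-! ### Dimension and height in polynomial rings. -/

open MvPolynomial in
/-- An algebra embedding into a polynomial ring has Krull dimension at most the number of
variables. -/
theorem ringKrullDim_le_card_of_injective {K A τ : Type*} [Field K] [CommRing A] [Algebra K A]
    [Algebra.FiniteType K A] [Fintype τ] (f : A →ₐ[K] MvPolynomial τ K)
    (hf : Function.Injective f) : ringKrullDim A ≤ Fintype.card τ := by
  have : Nontrivial A := f.toRingHom.domain_nontrivial
  -- Noether normalization: transcendence degree bounds `s`, and chains of primes of `A` contract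
  -- strictly to the polynomial ring in `s` variables.
  obtain ⟨s, g, hg, hfin⟩ := exists_finite_inj_algHom_of_fg K A
  have hs : s ≤ Fintype.card τ := by
    have := lift_trdeg_le_of_injective (f.comp g) (hf.comp hg)
    simpa [MvPolynomial.trdeg_of_isDomain] using this
  algebraize [g.toRingHom]
  have h1 : Algebra.IsIntegral (MvPolynomial (Fin s) K) A :=
    Algebra.isIntegral_def.mpr hfin.to_isIntegral
  have h2 : ringKrullDim A ≤ ringKrullDim (MvPolynomial (Fin s) K) :=
    Order.krullDim_le_of_strictMono
      (PrimeSpectrum.comap (algebraMap (MvPolynomial (Fin s) K) A))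
      fun p q hpq => Ideal.IsIntegral.comap_lt_comap hpq
  refine h2.trans ?_
  rw [MvPolynomial.ringKrullDim_of_isNoetherianRing, ringKrullDim_eq_zero_of_field]
  simpa using hs

namespace MvPolynomial

variable {σ K : Type*} [Field K]

/-- A translation of affine space is an automorphism of the polynomial ring carrying one point ideal
to the other. -/
theorem height_vanishingIdeal_singleton_le (x y : σ → K) :
    (vanishingIdeal K {x}).height ≤ (vanishingIdeal K {y}).height := by
  let t (u : σ → K) : MvPolynomial σ K →ₐ[K] MvPolynomial σ K := aeval fun s => X s + C (u s)
  let e : MvPolynomial σ K ≃ₐ[K] MvPolynomial σ K :=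
    AlgEquiv.ofAlgHom (t (x - y)) (t (y - x))
      (by apply algHom_ext; intro s; simp [t]; ring) (by apply algHom_ext; intro s; simp [t]; ring)
  have : (vanishingIdeal K {y}).comap e.toRingEquiv = vanishingIdeal K {x} := by
    ext p
    simp only [Ideal.mem_comap, mem_vanishingIdeal_singleton_iff]
    have : (aeval y).comp (t (x - y)) = aeval (R := K) x := by
      ext s; simp [t]
    rw [← this]; rfl
  rw [← this, RingEquiv.height_comap]

/-- Some maximal ideal attains the Krull dimension; by the Nullstellensatz it is a point, and all
points have the same height. -/
theorem card_le_height_vanishingIdeal_singleton [Fintype σ] [IsAlgClosed K] (x : σ → K) :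
    (Fintype.card σ : ℕ∞) ≤ (vanishingIdeal K {x}).height := by
  have hd : ringKrullDim (MvPolynomial σ K) = (Fintype.card σ : ℕ∞) := by
    rw [ringKrullDim_of_isNoetherianRing, ringKrullDim_eq_zero_of_field]
    simp
  have : FiniteRingKrullDim (MvPolynomial σ K) := by
    rw [finiteRingKrullDim_iff_ne_bot_and_top, hd]
    exact ⟨by simp, by simpa using (WithBot.coe_injective (α := ℕ∞)).ne (ENat.natCast_ne_top _)⟩
  obtain ⟨p, hp, hh⟩ := Ideal.exists_isMaximal_height (R := MvPolynomial σ K)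
  obtain ⟨y, rfl⟩ := eq_vanishingIdeal_singleton_of_isMaximal K hp
  rw [hd] at hh
  exact (WithBot.coe_injective hh).symm.le.trans
    (height_vanishingIdeal_singleton_le y x)

/-- `r` polynomial equations satisfied at a point `x` of `N`-space admit a chain of primes of
length at least `N - r` containing the equations and contained in the ideal of `x`. -/
theorem exists_ltSeries_primeSpectrum_of_mem [Fintype σ] [IsAlgClosed K] (x : σ → K)
    (E : Finset (MvPolynomial σ K)) (hE : ∀ e ∈ E, aeval x e = 0) :
    ∃ l : LTSeries (PrimeSpectrum (MvPolynomial σ K)),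
      l.last.asIdeal ≤ vanishingIdeal K {x} ∧ (∀ e ∈ E, e ∈ l.head.asIdeal) ∧
      Fintype.card σ ≤ l.length + E.card := by
  set I := Ideal.span (E : Set (MvPolynomial σ K))
  have hIx : I ≤ vanishingIdeal K {x} :=
    Ideal.span_le.mpr fun e he => (mem_vanishingIdeal_singleton_iff x e).mpr (hE e he)
  have : ((vanishingIdeal K {x}).map (Ideal.Quotient.mk I)).IsPrime :=
    Ideal.isPrime_map_quotientMk_of_isPrime hIx
  obtain ⟨l, hl, hlen⟩ :=
    ((vanishingIdeal K {x}).map (Ideal.Quotient.mk I)).exists_ltSeries_length_eq_height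
  refine ⟨l.map (PrimeSpectrum.comap (Ideal.Quotient.mk I))
    (RingHom.strictMono_comap_of_surjective Ideal.Quotient.mk_surjective), ?_, ?_, ?_⟩
  · rw [LTSeries.last_map, hl]
    change Ideal.comap _ (Ideal.map _ _) ≤ _
    rw [Ideal.comap_map_of_surjective _ Ideal.Quotient.mk_surjective]
    refine sup_le le_rfl ?_
    rw [← RingHom.ker_eq_comap_bot, Ideal.mk_ker]
    exact hIx
  · intro e he
    rw [LTSeries.head_map]
    change Ideal.Quotient.mk I e ∈ l.head.asIdeal
    rw [Ideal.Quotient.eq_zero_iff_mem.mpr (Ideal.subset_span he)]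
    exact zero_mem _
  · have h1 := card_le_height_vanishingIdeal_singleton x
    -- Krull's height theorem: passing to the quotient by `I` lowers the height by at most the
    -- number of generators.
    have h2 := Ideal.height_le_height_add_encard_of_subset
      (E : Set (MvPolynomial σ K)) (p := vanishingIdeal K {x}) (Ideal.span_le.mp hIx)
    rw [← hlen, Set.encard_coe_eq_coe_finsetCard] at h2
    exact_mod_cast h1.trans h2

end MvPolynomial

/-! ### Zariski closed sets, irreducibility and Krull dimension. -/

section ZariskiTopology

open MvPolynomial

attribute [local instance] zariskiTopology

variable {σ K : Type*} [Field K]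

theorem zariski_isClosed_iff {Z : Set (σ → K)} :
    IsClosed Z ↔ ∃ I : Ideal (MvPolynomial σ K), Z = zeroLocus K I := by
  rw [← isOpen_compl_iff]
  change (Zᶜᶜ ∈ {Z | ∃ I : Ideal (MvPolynomial σ K), Z = zeroLocus K I}) ↔ _
  rw [compl_compl]
  rfl

theorem isClosed_zeroLocus (I : Ideal (MvPolynomial σ K)) : IsClosed (zeroLocus K I) :=
  zariski_isClosed_iff.mpr ⟨I, rfl⟩

theorem isClosed_setOf_eval_eq_zero (q : MvPolynomial σ K) : IsClosed {x : σ → K | eval x q = 0} := by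
  convert isClosed_zeroLocus (Ideal.span {q})
  ext x
  simp [zeroLocus_span, aeval_eq_eval]

theorem zariski_closure_eq (S : Set (σ → K)) :
    closure S = zeroLocus K (vanishingIdeal K S) := by
  refine (closure_minimal (zeroLocus_vanishingIdeal_le S) (isClosed_zeroLocus _)).antisymm ?_
  obtain ⟨I, hI⟩ := zariski_isClosed_iff.mp (isClosed_closure (s := S))
  rw [hI]
  apply zeroLocus_anti_mono
  rw [← le_zeroLocus_iff_le_vanishingIdeal, ← hI]
  exact subset_closure

theorem isPrime_vanishingIdeal {S : Set (σ → K)} (hS : IsIrreducible S) :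
    (vanishingIdeal K S).IsPrime := by
  refine ⟨?_, ?_⟩
  · obtain ⟨x, hx⟩ := hS.nonempty
    intro h
    have : (1 : MvPolynomial σ K) ∈ vanishingIdeal K S := h ▸ Submodule.mem_top
    simpa using this x hx
  · intro p q hpq
    have := isPreirreducible_iff_isClosed_union_isClosed.mp hS.isPreirreducible _ _
      (isClosed_setOf_eval_eq_zero p) (isClosed_setOf_eval_eq_zero q) (fun x hx => by
        have := hpq x hx
        simpa [aeval_eq_eval] using this)
    exact this.imp (fun h x hx => by simpa [aeval_eq_eval] using h hx)
      (fun h x hx => by simpa [aeval_eq_eval] using h hx)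

theorem isIrreducible_zeroLocus [IsAlgClosed K] [Finite σ] (P : Ideal (MvPolynomial σ K))
    [hP : P.IsPrime] : IsIrreducible (zeroLocus K P) := by
  refine ⟨?_, isPreirreducible_iff_isClosed_union_isClosed.mpr ?_⟩
  · rw [Set.nonempty_iff_ne_empty]
    intro h
    apply hP.ne_top
    rw [← IsPrime.vanishingIdeal_zeroLocus (K := K) P, h, vanishingIdeal_empty]
  · intro Z W hZ hW h
    obtain ⟨I, rfl⟩ := zariski_isClosed_iff.mp hZ
    obtain ⟨J, rfl⟩ := zariski_isClosed_iff.mp hW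
    have key : ∀ I : Ideal (MvPolynomial σ K), zeroLocus K P ⊆ zeroLocus K I ↔ I ≤ P := fun I => by
      rw [le_zeroLocus_iff_le_vanishingIdeal, IsPrime.vanishingIdeal_zeroLocus]
    rw [key, key, ← hP.mul_le, ← key]
    refine h.trans ?_
    rintro x (hx | hx)
    · exact zeroLocus_anti_mono Ideal.mul_le_left hx
    · exact zeroLocus_anti_mono Ideal.mul_le_right hx

/-- The Krull dimension of a set of points is at most that of its coordinate ring. -/
theorem topologicalKrullDim_le_ringKrullDim (S : Set (σ → K)) :
    topologicalKrullDim S ≤ ringKrullDim (MvPolynomial σ K ⧸ vanishingIdeal K S) := by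
  have hr : ringKrullDim (MvPolynomial σ K ⧸ vanishingIdeal K S) =
      Order.krullDim (PrimeSpectrum.zeroLocus (R := MvPolynomial σ K) (vanishingIdeal K S)) :=
    ringKrullDim_quotient _
  rw [hr, ← Order.krullDim_orderDual]
  let f : TopologicalSpace.IrreducibleCloseds S →
      (PrimeSpectrum.zeroLocus (R := MvPolynomial σ K) (vanishingIdeal K S))ᵒᵈ := fun W =>
    OrderDual.toDual ⟨⟨vanishingIdeal K (Subtype.val '' (W : Set S)), isPrime_vanishingIdeal
      (W.isIrreducible.image _ continuous_subtype_val.continuousOn)⟩,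
      vanishingIdeal_anti_mono (by rintro _ ⟨x, _, rfl⟩; exact x.2)⟩
  refine Order.krullDim_le_of_strictMono f (Monotone.strictMono_of_injective ?_ ?_)
  · intro W₁ W₂ h
    exact vanishingIdeal_anti_mono (Set.image_mono h)
  -- A relatively closed set is the trace on `S` of its closure, so its vanishing ideal determines
  -- it.
  · have key : ∀ W : TopologicalSpace.IrreducibleCloseds S, (W : Set S) = Subtype.val ⁻¹'
        zeroLocus K (vanishingIdeal K (Subtype.val '' (W : Set S))) := fun W => by
      rw [← zariski_closure_eq, ← Topology.IsInducing.subtypeVal.closure_eq_preimage_closure_image,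
        W.isClosed.closure_eq]
    intro W₁ W₂ h
    have h' : vanishingIdeal K (Subtype.val '' (W₁ : Set S)) =
        vanishingIdeal K (Subtype.val '' (W₂ : Set S)) :=
      congrArg (fun z => (OrderDual.ofDual z).1.asIdeal) h
    apply SetLike.coe_injective
    rw [key W₁, key W₂, h']

/-- Polynomials killed by the substitution `φ` vanish on the closure of its image, hence on `S`. So
the coordinate ring of `S` is a quotient of a subalgebra of a polynomial ring in the variables `τ`.
-/
theorem topologicalKrullDim_le_card [Finite σ] {τ : Type*} [Fintype τ] (S : Set (σ → K))
    (φ : σ → MvPolynomial τ K)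
    (hS : S ⊆ closure (Set.range fun t : τ → K => fun s => eval t (φ s))) [Infinite K] :
    topologicalKrullDim S ≤ Fintype.card τ := by
  refine (topologicalKrullDim_le_ringKrullDim S).trans ?_
  let g : MvPolynomial σ K →ₐ[K] MvPolynomial τ K := aeval φ
  have hker : RingHom.ker g ≤ vanishingIdeal K S := by
    rw [← le_zeroLocus_iff_le_vanishingIdeal]
    refine hS.trans (closure_minimal ?_ (isClosed_zeroLocus _))
    rintro _ ⟨t, rfl⟩ q hq
    have h1 : (aeval t).comp g = aeval (R := K) fun s => eval t (φ s) := by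
      ext s; simp [g, aeval_eq_eval]
    rw [← h1, AlgHom.comp_apply, (RingHom.mem_ker).mp hq, map_zero]
  refine (ringKrullDim_le_of_surjective (Ideal.Quotient.factor hker)
    (Ideal.Quotient.factor_surjective hker)).trans ?_
  exact ringKrullDim_le_card_of_injective (Ideal.kerLiftAlg g) (Ideal.kerLiftAlg_injective g)

/-- Through a point satisfying `r` equations in `N`-space passes a chain of irreducible closed
subsets of the solution set of length at least `N - r`. -/
theorem exists_strictMono_irreducibleCloseds [Fintype σ] [IsAlgClosed K] (x : σ → K)
    (E : Finset (MvPolynomial σ K)) (hE : ∀ e ∈ E, eval x e = 0) :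
    ∃ (d : ℕ) (W : Fin (d + 1) → TopologicalSpace.IrreducibleCloseds (σ → K)), StrictMono W ∧
      x ∈ (W 0 : Set (σ → K)) ∧ (∀ y ∈ (W (Fin.last d) : Set (σ → K)), ∀ e ∈ E, eval y e = 0) ∧
      Fintype.card σ ≤ d + E.card := by
  obtain ⟨l, hl, hh, hc⟩ := exists_ltSeries_primeSpectrum_of_mem x E
    (by simpa [aeval_eq_eval] using hE)
  let f : PrimeSpectrum (MvPolynomial σ K) → TopologicalSpace.IrreducibleCloseds (σ → K) :=
    fun p => ⟨zeroLocus K p.asIdeal, isIrreducible_zeroLocus _, isClosed_zeroLocus _⟩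
  have hf : StrictAnti f := by
    refine Antitone.strictAnti_of_injective (fun p q h => zeroLocus_anti_mono h) fun p q h => ?_
    have h' : zeroLocus K p.asIdeal = zeroLocus K q.asIdeal := congrArg (fun z => z.carrier) h
    ext1
    rw [← IsPrime.vanishingIdeal_zeroLocus (K := K) p.asIdeal, h',
      IsPrime.vanishingIdeal_zeroLocus]
  -- The chain is read backwards: the largest prime, still inside the ideal of `x`, gives the
  -- smallest set.
  refine ⟨l.length, fun i => f (l (Fin.rev i)),
    fun i j hij => hf (l.strictMono (Fin.rev_lt_rev.mpr hij)), ?_, ?_, hc⟩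
  · beta_reduce
    rw [Fin.rev_zero]
    change x ∈ zeroLocus K l.last.asIdeal
    exact le_zeroLocus_iff_le_vanishingIdeal.mpr hl rfl
  · intro y hy e he
    beta_reduce at hy
    rw [Fin.rev_last] at hy
    change y ∈ zeroLocus K l.head.asIdeal at hy
    simpa [aeval_eq_eval] using hy e (hh e he)

end ZariskiTopology

theorem Topology.IsInducing.isIrreducible_preimage {X Y : Type*} [TopologicalSpace X]
    [TopologicalSpace Y] {f : X → Y} (hf : Topology.IsInducing f) {W : Set Y}
    (hW : IsIrreducible W) (hr : W ⊆ Set.range f) : IsIrreducible (f ⁻¹' W) := by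
  refine ⟨?_, ?_⟩
  · obtain ⟨y, hy⟩ := hW.nonempty
    obtain ⟨x, rfl⟩ := hr hy
    exact ⟨x, hy⟩
  · rintro u v hu hv ⟨x, hxW, hxu⟩ ⟨y, hyW, hyv⟩
    obtain ⟨u, hu', rfl⟩ := hf.isOpen_iff.mp hu
    obtain ⟨v, hv', rfl⟩ := hf.isOpen_iff.mp hv
    obtain ⟨z, hzW, hz⟩ := hW.isPreirreducible u v hu' hv' ⟨f x, hxW, hxu⟩ ⟨f y, hyW, hyv⟩
    obtain ⟨a, rfl⟩ := hr hzW
    exact ⟨a, hzW, hz⟩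

/-- A strict chain of irreducible closed sets contained in `S` bounds the dimension of `S` from
below. -/
theorem le_topologicalKrullDim_of_strictMono {X : Type*} [TopologicalSpace X] {S : Set X} {d : ℕ}
    (W : Fin (d + 1) → TopologicalSpace.IrreducibleCloseds X) (hW : StrictMono W)
    (hS : (W (Fin.last d) : Set X) ⊆ S) : (d : WithBot ℕ∞) ≤ topologicalKrullDim S := by
  have hWS : ∀ i, (W i : Set X) ⊆ S := fun i =>
    Set.Subset.trans (hW.monotone (Fin.le_last i)) hS
  let V : Fin (d + 1) → TopologicalSpace.IrreducibleCloseds S := fun i =>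
    ⟨Subtype.val ⁻¹' (W i : Set X), Topology.IsInducing.subtypeVal.isIrreducible_preimage
      (W i).isIrreducible (by simpa using hWS i), (W i).isClosed.preimage continuous_subtype_val⟩
  have hV : StrictMono V := by
    refine Monotone.strictMono_of_injective
      (fun i j h x hx => hW.monotone h hx) fun i j h => hW.injective ?_
    have h' : (Subtype.val ⁻¹' (W i : Set X) : Set S) = Subtype.val ⁻¹' (W j : Set X) :=
      congrArg (fun z => z.carrier) h
    apply SetLike.coe_injective
    rw [Subtype.preimage_val_eq_preimage_val_iff, Set.inter_eq_right.mpr (hWS i),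
      Set.inter_eq_right.mpr (hWS j)] at h'
    exact h'
  exact Order.LTSeries.length_le_krullDim (LTSeries.mk d V hV)

/-! ### Transfer to pairs of matrices. -/

section PairZariski

open MvPolynomial

attribute [local instance] zariskiTopology pairZariski

variable {K : Type*} [Field K] {n : ℕ}

theorem isInducing_pairCoords : Topology.IsInducing (pairCoords K n) := ⟨rfl⟩

theorem pairCoords_surjective {K : Type*} {n : ℕ} : Function.Surjective (pairCoords K n) := fun x =>
  ⟨(Matrix.of fun i j => x (Sum.inl (i, j)), Matrix.of fun i j => x (Sum.inr (i, j))), by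
    ext (s | s) <;> rfl⟩

theorem isClosed_setOf_eval_pairCoords (q : MvPolynomial ((Fin n × Fin n) ⊕ (Fin n × Fin n)) K) :
    IsClosed {p : MatPair K n | eval (pairCoords K n p) q = 0} :=
  (isClosed_setOf_eval_eq_zero q).preimage isInducing_pairCoords.continuous

theorem pair_isClosed_iff {Z : Set (MatPair K n)} : IsClosed Z ↔
    ∃ I : Ideal (MvPolynomial ((Fin n × Fin n) ⊕ (Fin n × Fin n)) K),
      Z = {p | ∀ q ∈ I, eval (pairCoords K n p) q = 0} := by
  rw [isInducing_pairCoords.isClosed_iff]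
  constructor
  · rintro ⟨T, hT, rfl⟩
    obtain ⟨I, rfl⟩ := zariski_isClosed_iff.mp hT
    exact ⟨I, by ext; simp [aeval_eq_eval]⟩
  · rintro ⟨I, rfl⟩
    exact ⟨_, isClosed_zeroLocus I, by ext; simp [aeval_eq_eval]⟩

/-- Upper bound for the dimension of a set of pairs by the number of parameters of a dense
polynomial parametrization. -/
theorem zariskiDim_le_card [Infinite K] {τ : Type*} [Fintype τ] (S : Set (MatPair K n))
    (A B : Matrix (Fin n) (Fin n) (MvPolynomial τ K))
    (hS : S ⊆ zariskiClosure K n (Set.range fun t : τ → K => (A.map (eval t), B.map (eval t)))) :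
    zariskiDim K n S ≤ Fintype.card τ := by
  have h1 : Topology.IsInducing (Set.restrictPreimage (pairCoords K n '' S) (pairCoords K n)) :=
    isInducing_pairCoords.restrictPreimage _
  have h2 : topologicalKrullDim S ≤ topologicalKrullDim (pairCoords K n ⁻¹' (pairCoords K n '' S)) :=
    (Topology.IsEmbedding.inclusion (Set.subset_preimage_image _ S)).isInducing.topologicalKrullDim_le
  refine (h2.trans h1.topologicalKrullDim_le).trans
    (topologicalKrullDim_le_card _ (Sum.elim (fun e => A e.1 e.2) (fun e => B e.1 e.2)) ?_)
  rintro _ ⟨p, hp, rfl⟩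
  have := hS hp
  rw [zariskiClosure, isInducing_pairCoords.closure_eq_preimage_closure_image,
    ← Set.range_comp] at this
  have h3 : (fun (t : τ → K) s => eval t (Sum.elim (fun e => A e.1 e.2) (fun e => B e.1 e.2) s)) =
      pairCoords K n ∘ fun t => (A.map (eval t), B.map (eval t)) := by
    ext t (e | e) <;> rfl
  rw [h3]
  exact this

theorem exists_strictMono_irreducibleCloseds_pair [IsAlgClosed K] (p : MatPair K n)
    (E : Finset (MvPolynomial ((Fin n × Fin n) ⊕ (Fin n × Fin n)) K))
    (hE : ∀ e ∈ E, eval (pairCoords K n p) e = 0) :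
    ∃ (d : ℕ) (W : Fin (d + 1) → TopologicalSpace.IrreducibleCloseds (MatPair K n)),
      StrictMono W ∧ p ∈ (W 0 : Set (MatPair K n)) ∧
      (∀ q ∈ (W (Fin.last d) : Set (MatPair K n)), ∀ e ∈ E, eval (pairCoords K n q) e = 0) ∧
      2 * n ^ 2 ≤ d + E.card := by
  obtain ⟨d, W, hW, h0, hl, hd⟩ := exists_strictMono_irreducibleCloseds (pairCoords K n p) E hE
  let V : Fin (d + 1) → TopologicalSpace.IrreducibleCloseds (MatPair K n) := fun i =>
    ⟨pairCoords K n ⁻¹' (W i : Set _),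
      isInducing_pairCoords.isIrreducible_preimage (W i).isIrreducible
        (by simp [pairCoords_surjective.range_eq]),
      (W i).isClosed.preimage isInducing_pairCoords.continuous⟩
  refine ⟨d, V, ?_, h0, fun q hq => hl _ hq, ?_⟩
  · refine Monotone.strictMono_of_injective
      (fun i j h x hx => hW.monotone h hx) fun i j h => hW.injective ?_
    apply SetLike.coe_injective
    exact pairCoords_surjective.preimage_injective (congrArg (fun z => z.carrier) h)
  · refine le_trans (le_of_eq ?_) hd
    simp
    ring

/-- The three families serve for the entries of the first matrix, of the second, and of the
commutator; equations are counted by their indices. -/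
theorem exists_strictMono_irreducibleCloseds_of_families [IsAlgClosed K] (p : MatPair K n)
    {ι : Type*} (s t u : Finset ι)
    (f g h : ι → MvPolynomial ((Fin n × Fin n) ⊕ (Fin n × Fin n)) K)
    (hf : ∀ e ∈ s, eval (pairCoords K n p) (f e) = 0)
    (hg : ∀ e ∈ t, eval (pairCoords K n p) (g e) = 0)
    (hh : ∀ e ∈ u, eval (pairCoords K n p) (h e) = 0) :
    ∃ (d : ℕ) (W : Fin (d + 1) → TopologicalSpace.IrreducibleCloseds (MatPair K n)),
      StrictMono W ∧ p ∈ (W 0 : Set (MatPair K n)) ∧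
      (∀ q ∈ (W (Fin.last d) : Set (MatPair K n)),
        (∀ e ∈ s, eval (pairCoords K n q) (f e) = 0) ∧
        (∀ e ∈ t, eval (pairCoords K n q) (g e) = 0) ∧
        ∀ e ∈ u, eval (pairCoords K n q) (h e) = 0) ∧
      2 * n ^ 2 ≤ d + (s.card + t.card + u.card) := by
  classical
  have key (q : MatPair K n) : (∀ e ∈ s.image f ∪ t.image g ∪ u.image h,
      eval (pairCoords K n q) e = 0) ↔ (∀ e ∈ s, eval (pairCoords K n q) (f e) = 0) ∧
        (∀ e ∈ t, eval (pairCoords K n q) (g e) = 0) ∧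
        ∀ e ∈ u, eval (pairCoords K n q) (h e) = 0 := by
    simp only [Finset.forall_mem_union, Finset.forall_mem_image, and_assoc]
  obtain ⟨d, W, hW, h0, hl, hd⟩ :=
    exists_strictMono_irreducibleCloseds_pair p _ ((key p).mpr ⟨hf, hg, hh⟩)
  refine ⟨d, W, hW, h0, fun q hq => (key q).mp (hl q hq),
    hd.trans (Nat.add_le_add_left ?_ d)⟩
  refine (Finset.card_union_le _ _).trans (add_le_add ((Finset.card_union_le _ _).trans
    (add_le_add ?_ ?_)) ?_) <;> exact Finset.card_image_le

theorem le_zariskiDim_of_strictMono {S : Set (MatPair K n)} {d : ℕ}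
    (W : Fin (d + 1) → TopologicalSpace.IrreducibleCloseds (MatPair K n)) (hW : StrictMono W)
    (hS : (W (Fin.last d) : Set (MatPair K n)) ⊆ S) : (d : WithBot ℕ∞) ≤ zariskiDim K n S :=
  le_topologicalKrullDim_of_strictMono W hW hS

/-- The first generic matrix of a pair. -/
noncomputable def genericFst (K : Type*) [Field K] (n : ℕ) :
    Matrix (Fin n) (Fin n) (MvPolynomial ((Fin n × Fin n) ⊕ (Fin n × Fin n)) K) :=
  Matrix.of fun i j => X (Sum.inl (i, j))

/-- The second generic matrix of a pair. -/
noncomputable def genericSnd (K : Type*) [Field K] (n : ℕ) :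
    Matrix (Fin n) (Fin n) (MvPolynomial ((Fin n × Fin n) ⊕ (Fin n × Fin n)) K) :=
  Matrix.of fun i j => X (Sum.inr (i, j))

@[simp]
theorem eval_genericFst (p : MatPair K n) (i j : Fin n) :
    eval (pairCoords K n p) (genericFst K n i j) = p.1 i j := by
  simp [genericFst, pairCoords]

@[simp]
theorem eval_genericSnd (p : MatPair K n) (i j : Fin n) :
    eval (pairCoords K n p) (genericSnd K n i j) = p.2 i j := by
  simp [genericSnd, pairCoords]

@[simp]
theorem eval_lie_generic (p : MatPair K n) (i j : Fin n) :
    eval (pairCoords K n p) (⁅genericFst K n, genericSnd K n⁆ i j) = ⁅p.1, p.2⁆ i j := by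
  simp [Ring.lie_def, Matrix.mul_apply]

end PairZariski

/-! ### Regular matrices and their commutants. -/

section Regular

open Polynomial

variable {K : Type*} [Field K] {n : ℕ}

theorem upperTri_isUpperTriangular {A : Matrix (Fin n) (Fin n) K} (hA : A ∈ upperTri K n) :
    A.IsUpperTriangular := fun i j hij => hA i j hij

/-- The diagonal entries are eigenvalues, so the minimal polynomial has `n` distinct roots. -/
theorem isRegularMatrix_of_injective_diag {A : Matrix (Fin n) (Fin n) K} (hA : A ∈ upperTri K n)
    (hd : Function.Injective fun i => A i i) : IsRegularMatrix K n A := by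
  have hch := Matrix.charpoly_of_isUpperTriangular A (upperTri_isUpperTriangular hA)
  have hroot : ∀ i, (minpoly K A).IsRoot (A i i) := fun i => by
    rw [← Matrix.minpoly_toLin', ← Module.End.hasEigenvalue_iff_isRoot,
      Module.End.hasEigenvalue_iff_isRoot_charpoly, Matrix.charpoly_toLin', hch]
    simp only [IsRoot.def, eval_prod]
    exact Finset.prod_eq_zero (Finset.mem_univ i) (by simp)
  have hne : minpoly K A ≠ 0 := minpoly.ne_zero (Algebra.IsIntegral.isIntegral A)
  apply le_antisymm
  · refine (natDegree_le_of_dvd (Matrix.minpoly_dvd_charpoly A) A.charpoly_monic.ne_zero).trans ?_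
    simp [Matrix.charpoly_natDegree_eq_dim]
  · classical
    have h1 : Finset.univ.image (fun i => A i i) ⊆ (minpoly K A).roots.toFinset := by
      intro a ha
      obtain ⟨i, -, rfl⟩ := Finset.mem_image.mp ha
      simpa [hne] using hroot i
    have h2 := (Finset.card_le_card h1).trans
      ((Multiset.toFinset_card_le _).trans (card_roots' _))
    rwa [Finset.card_image_of_injective _ hd, Finset.card_univ, Fintype.card_fin] at h2

theorem not_isRegularMatrix_of_sub_smul_one_pow_eq_zero {A : Matrix (Fin n) (Fin n) K} {c : K}
    {m : ℕ} (h : (A - c • 1) ^ m = 0) (hm : m < n) : ¬ IsRegularMatrix K n A := by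
  have h1 : aeval A ((X - C c) ^ m) = 0 := by
    rw [map_pow, map_sub, aeval_X, aeval_C, Algebra.algebraMap_eq_smul_one, h]
  have h2 := natDegree_le_of_dvd (minpoly.dvd K A h1) (pow_ne_zero m (X_sub_C_ne_zero c))
  rw [natDegree_pow, natDegree_X_sub_C] at h2
  unfold IsRegularMatrix
  omega

/-- Every square matrix over an infinite field has a vector whose annihilating polynomials are
exactly the multiples of the minimal polynomial. -/
theorem exists_vector_minpoly_dvd [Infinite K] (A : Matrix (Fin n) (Fin n) K) :
    ∃ v : Fin n → K, ∀ q : K[X], (aeval A q).mulVec v = 0 → minpoly K A ∣ q := by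
  classical
  set m := minpoly K A
  have hne : m ≠ 0 := minpoly.ne_zero (Algebra.IsIntegral.isIntegral A)
  let T := (UniqueFactorizationMonoid.normalizedFactors m).toFinset
  have hT : ∀ f ∈ T, ∃ g, m = f * g := fun f hf =>
    UniqueFactorizationMonoid.dvd_of_mem_normalizedFactors (Multiset.mem_toFinset.mp hf)
  choose! g hg using hT
  -- For each prime factor `f` of `m = f * g f`, minimality gives `g f` nonzero value at `A`, so its
  -- kernel is proper. Finitely many proper subspaces do not cover the space; `v` is chosen outside
  -- all of them.
  let s : Finset (Subspace K (Fin n → K)) :=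
    T.image fun f => LinearMap.ker (aeval A (g f)).mulVecLin
  have hs : ⊤ ∉ s := by
    intro h
    obtain ⟨f, hf, h⟩ := Finset.mem_image.mp h
    have h0 : aeval A (g f) = 0 := by
      rw [LinearMap.ker_eq_top] at h
      apply Matrix.toLin'.injective
      rw [Matrix.toLin'_apply', h, map_zero]
    have hfi : Irreducible f :=
      UniqueFactorizationMonoid.irreducible_of_normalized_factor f (Multiset.mem_toFinset.mp hf)
    obtain ⟨c, hc⟩ := minpoly.dvd K A h0
    have hgf : g f ≠ 0 := fun h => hne (by rw [hg f hf, h, mul_zero])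
    have : g f = g f * (f * c) := by
      calc g f = m * c := hc
        _ = f * g f * c := by rw [← hg f hf]
        _ = _ := by ring
    exact hfi.not_isUnit
      (IsUnit.of_mul_eq_one c (mul_left_cancel₀ hgf (by rw [mul_one]; exact this.symm)))
  have hv := Subspace.biUnion_ne_univ_of_top_notMem hs
  obtain ⟨v, hv⟩ := (Set.ne_univ_iff_exists_notMem _).mp hv
  refine ⟨v, fun q hq => ?_⟩
  simp only [Set.mem_iUnion, not_exists] at hv
  let d := EuclideanDomain.gcd m q
  have hd : (aeval A d).mulVec v = 0 := by
    have : d = m * EuclideanDomain.gcdA m q + q * EuclideanDomain.gcdB m q :=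
      EuclideanDomain.gcd_eq_gcd_ab m q
    rw [this, map_add, map_mul, minpoly.aeval, zero_mul, zero_add, mul_comm q, map_mul,
      ← Matrix.mulVec_mulVec, hq, Matrix.mulVec_zero]
  obtain ⟨e, he⟩ : d ∣ m := EuclideanDomain.gcd_dvd_left m q
  have hdq : d ∣ q := EuclideanDomain.gcd_dvd_right m q
  have hene : e ≠ 0 := fun h => hne (by rw [he, h, mul_zero])
  -- If `e` had a prime factor `f'`, then `d` would divide `g f'`, placing `v` in one of the avoided
  -- kernels.
  have heu : IsUnit e := by
    by_contra hnu
    obtain ⟨f, hf, hfe⟩ := WfDvdMonoid.exists_irreducible_factor hnu hene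
    obtain ⟨f', hf', hff⟩ := UniqueFactorizationMonoid.exists_mem_normalizedFactors_of_dvd hne hf
      (hfe.trans (Dvd.intro_left d he.symm))
    have hf'T : f' ∈ T := Multiset.mem_toFinset.mpr hf'
    obtain ⟨c, hc⟩ : f' ∣ e := hff.symm.dvd.trans hfe
    refine hv _ (Finset.mem_image_of_mem _ hf'T) ?_
    have hf'0 : f' ≠ 0 := fun h => hne (by rw [hg f' hf'T, h, zero_mul])
    have : g f' = c * d := by
      apply mul_left_cancel₀ hf'0
      rw [← hg f' hf'T, he, hc]; ring
    simp only [SetLike.mem_coe, LinearMap.mem_ker, Matrix.mulVecLin_apply]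
    rw [this, map_mul, ← Matrix.mulVec_mulVec, hd, Matrix.mulVec_zero]
  rw [he, heu.mul_right_dvd]
  exact hdq

/-- Regularity makes the vector `v` of `exists_vector_minpoly_dvd` cyclic. Some polynomial in `A`
agrees with `B` at `v`; as both commute with `A`, they agree on every `A ^ k` applied to `v`, hence
everywhere. -/
theorem exists_sum_pow_of_commute_of_isRegularMatrix [Infinite K] {A B : Matrix (Fin n) (Fin n) K}
    (hA : IsRegularMatrix K n A) (hAB : Commute A B) :
    ∃ c : Fin n → K, B = ∑ k : Fin n, c k • A ^ (k : ℕ) := by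
  obtain ⟨v, hv⟩ := exists_vector_minpoly_dvd A
  let L : (Fin n → K) →ₗ[K] (Fin n → K) :=
    Fintype.linearCombination K fun k : Fin n => (A ^ (k : ℕ)).mulVec v
  have hL : ∀ c, L c = (∑ k : Fin n, c k • A ^ (k : ℕ)).mulVec v := fun c => by
    simp [L, Fintype.linearCombination_apply, Matrix.sum_mulVec, Matrix.smul_mulVec]
  have hinj : Function.Injective L := by
    rw [← LinearMap.ker_eq_bot, LinearMap.ker_eq_bot']
    intro c hc
    let q : K[X] := ∑ k : Fin n, monomial (k : ℕ) (c k)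
    have hq : aeval A q = ∑ k : Fin n, c k • A ^ (k : ℕ) := by
      simp [q, aeval_monomial, Algebra.smul_def]
    have hdvd := hv q (by rw [hq, ← hL, hc])
    have hq0 : q = 0 := by
      refine eq_zero_of_dvd_of_degree_lt hdvd ?_
      have hne : minpoly K A ≠ 0 := minpoly.ne_zero (Algebra.IsIntegral.isIntegral A)
      rw [degree_eq_natDegree hne, show (minpoly K A).natDegree = n from hA]
      simp only [q, ← C_mul_X_pow_eq_monomial]
      exact degree_sum_fin_lt c
    ext k
    have : q.coeff k = c k := by
      simp [q, coeff_monomial, Fin.val_inj]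
    rw [← this, hq0]; simp
  have hsurj : Function.Surjective L := LinearMap.injective_iff_surjective.mp hinj
  obtain ⟨c, hc⟩ := hsurj (B.mulVec v)
  refine ⟨c, ?_⟩
  set P := ∑ k : Fin n, c k • A ^ (k : ℕ)
  have hPA : Commute P A := Commute.sum_left _ _ _ fun k _ =>
    ((Commute.refl A).pow_left _).smul_left _
  have hPv : B.mulVec v = P.mulVec v := by rw [← hc, hL]
  have hBA : ∀ m : ℕ, B.mulVec ((A ^ m).mulVec v) = P.mulVec ((A ^ m).mulVec v) := fun m => by
    rw [Matrix.mulVec_mulVec, Matrix.mulVec_mulVec, ← (hAB.pow_left m).eq, (hPA.pow_right m).eq,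
      ← Matrix.mulVec_mulVec, ← Matrix.mulVec_mulVec, hPv]
  apply Matrix.mulVec_injective
  funext w
  obtain ⟨e, rfl⟩ := hsurj w
  simp only [hL, Matrix.sum_mulVec, Matrix.smul_mulVec, Matrix.mulVec_sum, Matrix.mulVec_smul, hBA]

end Regular

/-! ### Commuting triangular pairs: `CT`, `CT0` and change of size. -/

section CommutingTriangular

open MvPolynomial

attribute [local instance] zariskiTopology pairZariski

variable {K : Type*} [Field K] {n : ℕ}

theorem lie_apply_eq_zero_of_upperTri {A B : Matrix (Fin n) (Fin n) K} (hA : A ∈ upperTri K n)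
    (hB : B ∈ upperTri K n) {i j : Fin n} (hij : j ≤ i) : ⁅A, B⁆ i j = 0 := by
  rw [Ring.lie_def, Matrix.sub_apply, Matrix.mul_apply, Matrix.mul_apply, sub_eq_zero]
  refine Finset.sum_congr rfl fun k _ => ?_
  rcases lt_trichotomy k i with hk | rfl | hk
  · rw [hA i k hk, hB i k hk, zero_mul, zero_mul]
  · rcases hij.lt_or_eq with h | rfl
    · rw [hA k j h, hB k j h, mul_zero, mul_zero]
    · exact mul_comm _ _
  · rw [hA k j (hij.trans_lt hk), hB k j (hij.trans_lt hk), mul_zero, mul_zero]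

theorem mem_CT_iff {p : MatPair K n} : p ∈ CT K n ↔
    (∀ i j, j < i → p.1 i j = 0) ∧ (∀ i j, j < i → p.2 i j = 0) ∧
      ∀ i j, i < j → ⁅p.1, p.2⁆ i j = 0 := by
  refine ⟨fun h => ⟨h.1, h.2.1, fun i j _ => by rw [h.2.2]; rfl⟩, fun h => ⟨h.1, h.2.1, ?_⟩⟩
  ext i j
  rcases lt_or_ge i j with hij | hij
  · exact h.2.2 i j hij
  · exact lie_apply_eq_zero_of_upperTri h.1 h.2.1 hij

theorem isClosed_CT : IsClosed (CT K n) := by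
  have h : CT K n = (⋂ (i) (j) (_ : j < i), {p | eval (pairCoords K n p) (genericFst K n i j) = 0}) ∩
      ((⋂ (i) (j) (_ : j < i), {p | eval (pairCoords K n p) (genericSnd K n i j) = 0}) ∩
      ⋂ (i) (j) (_ : i < j),
        {p | eval (pairCoords K n p) (⁅genericFst K n, genericSnd K n⁆ i j) = 0}) := by
    ext p
    rw [mem_CT_iff]
    simp
  rw [h]
  exact .inter (isClosed_iInter fun i => isClosed_iInter fun j => isClosed_iInter fun _ =>
    isClosed_setOf_eval_pairCoords _) (.inter (isClosed_iInter fun i => isClosed_iInter fun j =>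
    isClosed_iInter fun _ => isClosed_setOf_eval_pairCoords _) (isClosed_iInter fun i =>
    isClosed_iInter fun j => isClosed_iInter fun _ => isClosed_setOf_eval_pairCoords _))

theorem isOpen_setOf_injective_diag : IsOpen {p : MatPair K n |
    (Function.Injective fun i => p.1 i i) ∧ Function.Injective fun i => p.2 i i} := by
  have h : {p : MatPair K n |
      (Function.Injective fun i => p.1 i i) ∧ Function.Injective fun i => p.2 i i} =
      (⋂ (i) (j) (_ : i ≠ j),
        {p | eval (pairCoords K n p) (genericFst K n i i - genericFst K n j j) = 0}ᶜ) ∩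
      ⋂ (i) (j) (_ : i ≠ j),
        {p | eval (pairCoords K n p) (genericSnd K n i i - genericSnd K n j j) = 0}ᶜ := by
    ext p
    simp [Function.Injective, sub_eq_zero, not_imp_not]
  rw [h]
  have key (q : MvPolynomial ((Fin n × Fin n) ⊕ (Fin n × Fin n)) K) :
      IsOpen {p | eval (pairCoords K n p) q = 0}ᶜ :=
    (isClosed_setOf_eval_pairCoords q).isOpen_compl
  exact .inter (isOpen_iInter_of_finite fun i => isOpen_iInter_of_finite fun j =>
      isOpen_iInter_of_finite fun _ => key _)
    (isOpen_iInter_of_finite fun i => isOpen_iInter_of_finite fun j =>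
      isOpen_iInter_of_finite fun _ => key _)

/-- An irreducible set of commuting triangular pairs lies in `CT0` as soon as it contains a pair
both of whose members have pairwise distinct diagonal entries. -/
theorem subset_CT0_of_isIrreducible {W : Set (MatPair K n)} (hW : IsIrreducible W)
    (hWC : W ⊆ CT K n) {p : MatPair K n} (hp : p ∈ W) (h1 : Function.Injective fun i => p.1 i i)
    (h2 : Function.Injective fun i => p.2 i i) : W ⊆ CT0 K n := by
  -- A nonempty relatively open subset of an irreducible set is dense in it.
  refine (subset_closure_inter_of_isPreirreducible_of_isOpen hW.isPreirreducible
    isOpen_setOf_injective_diag ⟨p, hp, h1, h2⟩).trans (closure_mono ?_)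
  rintro q ⟨hq, hq1, hq2⟩
  exact ⟨hWC hq, isRegularMatrix_of_injective_diag (hWC hq).1 hq1,
    isRegularMatrix_of_injective_diag (hWC hq).2.1 hq2⟩

theorem exists_mem_CT_injective_diag [Infinite K] : ∃ p ∈ CT K n,
    (Function.Injective fun i => p.1 i i) ∧ Function.Injective fun i => p.2 i i := by
  let D : Matrix (Fin n) (Fin n) K := Matrix.diagonal fun i => Infinite.natEmbedding K i
  have hD : D ∈ upperTri K n := fun i j hij => Matrix.diagonal_apply_ne _ hij.ne'
  have hi : Function.Injective fun i => D i i := fun i j h => by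
    simpa [D, Fin.val_inj] using h
  exact ⟨(D, D), ⟨hD, hD, sub_self _⟩, hi, hi⟩

theorem zariskiDim_CT0_le [Infinite K] : zariskiDim K n (CT0 K n) ≤
    ((Fintype.card {e : Fin n × Fin n // e.1 ≤ e.2} + n : ℕ) : WithBot ℕ∞) := by
  let A : Matrix (Fin n) (Fin n) (MvPolynomial ({e : Fin n × Fin n // e.1 ≤ e.2} ⊕ Fin n) K) :=
    Matrix.of fun i j => if h : i ≤ j then X (Sum.inl ⟨(i, j), h⟩) else 0
  let B := ∑ k : Fin n, (X (Sum.inr k) :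
    MvPolynomial ({e : Fin n × Fin n // e.1 ≤ e.2} ⊕ Fin n) K) • A ^ (k : ℕ)
  have := zariskiDim_le_card (CT0 K n) A B (closure_mono ?_)
  · simpa using this
  rintro ⟨P, Q⟩ ⟨⟨hP, hQ, hPQ⟩, hr, -⟩
  obtain ⟨c, hc⟩ := exists_sum_pow_of_commute_of_isRegularMatrix hr
    (sub_eq_zero.mp hPQ : Commute P Q)
  refine ⟨Sum.elim (fun e => P e.1.1 e.1.2) c, ?_⟩
  set t : {e : Fin n × Fin n // e.1 ≤ e.2} ⊕ Fin n → K := Sum.elim (fun e => P e.1.1 e.1.2) c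
  have hA : A.map (eval t) = P := by
    ext i j
    by_cases h : i ≤ j
    · simp [A, h, t]
    · simpa [A, h] using (hP i j (not_le.mp h)).symm
  have hB : B.map (eval t) = Q := by
    have h1 : ∀ k : Fin n, (A ^ (k : ℕ)).map (eval t) = P ^ (k : ℕ) := fun k => by
      rw [← hA]
      exact map_pow (eval t).mapMatrix A k
    calc B.map (eval t) = ∑ k : Fin n, c k • (A ^ (k : ℕ)).map (eval t) := by
          ext i j
          simp [B, Matrix.sum_apply, t]
      _ = Q := by rw [hc]; exact Finset.sum_congr rfl fun k _ => by rw [h1]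
  exact Prod.ext hA hB

/-- The chain is started at a pair with distinct diagonal entries. Its top member is then an
irreducible subset of `CT` through that pair, which forces it into `CT0`. -/
theorem le_zariskiDim_CT0 [IsAlgClosed K] : ∃ d : ℕ, (d : WithBot ℕ∞) ≤ zariskiDim K n (CT0 K n) ∧
    2 * n ^ 2 ≤ d + (2 * (Finset.univ.filter fun e : Fin n × Fin n => e.2 < e.1).card +
      (Finset.univ.filter fun e : Fin n × Fin n => e.1 < e.2).card) := by
  obtain ⟨p, hp, h1, h2⟩ := exists_mem_CT_injective_diag (K := K) (n := n)
  obtain ⟨d, W, hW, h0, hl, hd⟩ := exists_strictMono_irreducibleCloseds_of_families p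
    (Finset.univ.filter fun e : Fin n × Fin n => e.2 < e.1)
    (Finset.univ.filter fun e : Fin n × Fin n => e.2 < e.1)
    (Finset.univ.filter fun e : Fin n × Fin n => e.1 < e.2)
    (fun e => genericFst K n e.1 e.2) (fun e => genericSnd K n e.1 e.2)
    (fun e => ⁅genericFst K n, genericSnd K n⁆ e.1 e.2)
    (by simpa using (mem_CT_iff.mp hp).1) (by simpa using (mem_CT_iff.mp hp).2.1)
    (by simpa using (mem_CT_iff.mp hp).2.2)
  refine ⟨d, le_zariskiDim_of_strictMono W hW ?_, by omega⟩
  refine subset_CT0_of_isIrreducible (W _).isIrreducible (fun q hq => ?_)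
    (hW.monotone (Fin.zero_le _) h0) h1 h2
  rw [mem_CT_iff]
  simpa using hl q hq

theorem CT_subset_CT0_of_zariskiIrreducible [Infinite K] (h : ZariskiIrreducible K n (CT K n)) :
    CT K n ⊆ CT0 K n := by
  obtain ⟨p, hp, h1, h2⟩ := exists_mem_CT_injective_diag (K := K) (n := n)
  exact subset_CT0_of_isIrreducible h subset_rfl hp h1 h2

/-- The restriction of a pair of matrices to the leading principal block. -/
def leadingBlock (K : Type*) (n : ℕ) (p : MatPair K (n + 1)) : MatPair K n :=
  (p.1.submatrix Fin.castSucc Fin.castSucc, p.2.submatrix Fin.castSucc Fin.castSucc)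

theorem continuous_leadingBlock : Continuous (leadingBlock K n) := by
  rw [continuous_iff_isClosed]
  intro Z hZ
  obtain ⟨I, rfl⟩ := pair_isClosed_iff.mp hZ
  let g : (Fin n × Fin n) ⊕ (Fin n × Fin n) →
      (Fin (n + 1) × Fin (n + 1)) ⊕ (Fin (n + 1) × Fin (n + 1)) :=
    Sum.map (Prod.map Fin.castSucc Fin.castSucc) (Prod.map Fin.castSucc Fin.castSucc)
  have hg : ∀ p, pairCoords K n (leadingBlock K n p) = pairCoords K (n + 1) p ∘ g := fun p => by
    ext (e | e) <;> rfl
  have h : leadingBlock K n ⁻¹' {p | ∀ q ∈ I, eval (pairCoords K n p) q = 0} =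
      ⋂ q ∈ I, {p | eval (pairCoords K (n + 1) p) (rename g q) = 0} := by
    ext p
    simp [hg, eval_rename]
  rw [h]
  exact isClosed_biInter fun q _ => isClosed_setOf_eval_pairCoords _

/-- The last row of a triangular matrix vanishes off the diagonal, so truncation respects products;
padding by a zero row and column gives surjectivity. -/
theorem leadingBlock_image_CT : leadingBlock K n '' CT K (n + 1) = CT K n := by
  apply Set.Subset.antisymm
  · rintro _ ⟨⟨A, B⟩, ⟨hA, hB, hAB⟩, rfl⟩
    refine ⟨fun i j h => hA _ _ (Fin.castSucc_lt_castSucc_iff.mpr h),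
      fun i j h => hB _ _ (Fin.castSucc_lt_castSucc_iff.mpr h), ?_⟩
    ext i j
    have := congrFun (congrFun hAB i.castSucc) j.castSucc
    have e1 : A (Fin.last n) j.castSucc = 0 := hA _ _ (Fin.castSucc_lt_last j)
    have e2 : B (Fin.last n) j.castSucc = 0 := hB _ _ (Fin.castSucc_lt_last j)
    simpa [Ring.lie_def, Matrix.mul_apply, Fin.sum_univ_castSucc, leadingBlock, e1, e2] using this
  · rintro ⟨A, B⟩ ⟨hA, hB, hAB⟩
    let ext0 (M : Matrix (Fin n) (Fin n) K) : Matrix (Fin (n + 1)) (Fin (n + 1)) K :=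
      Matrix.of fun i j => Fin.lastCases 0 (fun i' => Fin.lastCases 0 (fun j' => M i' j') j) i
    have hu : ∀ M ∈ upperTri K n, ext0 M ∈ upperTri K (n + 1) := by
      intro M hM i j hij
      cases i using Fin.lastCases with
      | last => simp [ext0]
      | cast i =>
        cases j using Fin.lastCases with
        | last => simp [ext0]
        | cast j => simpa [ext0] using hM i j (Fin.castSucc_lt_castSucc_iff.mp hij)
    refine ⟨(ext0 A, ext0 B), ⟨hu A hA, hu B hB, ?_⟩, ?_⟩
    · ext i j
      cases i using Fin.lastCases with
      | last => simp [ext0, Ring.lie_def, Matrix.mul_apply]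
      | cast i =>
        cases j using Fin.lastCases with
        | last => simp [ext0, Ring.lie_def, Matrix.mul_apply, Fin.sum_univ_castSucc]
        | cast j =>
          have := congrFun (congrFun hAB i) j
          simpa [ext0, Ring.lie_def, Matrix.mul_apply, Fin.sum_univ_castSucc] using this
    · ext i j <;> simp [leadingBlock, ext0]

theorem zariskiIrreducible_CT_of_succ (h : ZariskiIrreducible K (n + 1) (CT K (n + 1))) :
    ZariskiIrreducible K n (CT K n) := by
  rw [← leadingBlock_image_CT]
  exact IsIrreducible.image h _ continuous_leadingBlock.continuousOn

end CommutingTriangular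

/-! ### Block-strict commuting pairs and their translation orbit. -/

theorem StrictMono.exists_snoc {α : Type*} [Preorder α] {d : ℕ} {W : Fin (d + 1) → α}
    (hW : StrictMono W) {a : α} (ha : W (Fin.last d) < a) :
    ∃ V : Fin (d + 2) → α, StrictMono V ∧ V (Fin.last (d + 1)) = a := by
  refine ⟨Fin.snoc (α := fun _ => α) W a, ?_, by simp⟩
  rw [Fin.strictMono_iff_lt_succ]
  intro i
  cases i using Fin.lastCases with
  | last => simpa using ha
  | cast i =>
    rw [Fin.succ_castSucc, Fin.snoc_castSucc, Fin.snoc_castSucc]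
    exact hW Fin.castSucc_lt_succ

section BlockStrict

variable {K : Type*} [Field K] {n : ℕ} {b : Fin n → ℕ}

/-- Matrices whose `(i, j)` entry vanishes unless the level of `j` exceeds that of `i`. -/
def levelStrict (K : Type*) [Field K] (b : Fin n → ℕ) : Set (Matrix (Fin n) (Fin n) K) :=
  {A | ∀ i j, b j ≤ b i → A i j = 0}

theorem levelStrict_subset_strictUpperTri (hb : Monotone b) :
    levelStrict K b ⊆ strictUpperTri K n := fun _ hA i j hij => hA i j (hb hij)

/-- A level-strict factor raises the level by at least one. This underlies both the saving of
commutator equations and the nilpotency bound. -/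
theorem mul_apply_eq_zero_of_levelStrict {A B : Matrix (Fin n) (Fin n) K} (hA : A ∈ levelStrict K b)
    {m : ℕ} (hB : ∀ i j, b j < b i + m → B i j = 0) {i j : Fin n} (hij : b j < b i + (m + 1)) :
    (A * B) i j = 0 := by
  rw [Matrix.mul_apply]
  refine Finset.sum_eq_zero fun k _ => ?_
  rcases le_or_gt (b k) (b i) with h | h
  · rw [hA i k h, zero_mul]
  · rw [hB k j (by omega), mul_zero]

theorem lie_apply_eq_zero_of_levelStrict {A B : Matrix (Fin n) (Fin n) K}
    (hA : A ∈ levelStrict K b) (hB : B ∈ levelStrict K b) {i j : Fin n} (hij : b j < b i + 2) :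
    ⁅A, B⁆ i j = 0 := by
  rw [Ring.lie_def, Matrix.sub_apply,
    mul_apply_eq_zero_of_levelStrict hA (m := 1) (fun i j h => hB i j (by omega)) hij,
    mul_apply_eq_zero_of_levelStrict hB (m := 1) (fun i j h => hA i j (by omega)) hij, sub_zero]

theorem pow_apply_eq_zero_of_levelStrict {A : Matrix (Fin n) (Fin n) K} (hA : A ∈ levelStrict K b)
    (m : ℕ) : ∀ i j, b j < b i + m → (A ^ m) i j = 0 := by
  induction m with
  | zero =>
    intro i j h
    rw [pow_zero, Matrix.one_apply_ne]
    rintro rfl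
    omega
  | succ m ih =>
    intro i j h
    rw [pow_succ']
    exact mul_apply_eq_zero_of_levelStrict hA ih h

theorem pow_eq_zero_of_levelStrict {A : Matrix (Fin n) (Fin n) K} (hA : A ∈ levelStrict K b)
    {m : ℕ} (hm : ∀ i, b i < m) : A ^ m = 0 := by
  ext i j
  exact pow_apply_eq_zero_of_levelStrict hA m i j (Nat.lt_add_left _ (hm j))

/-- Commuting pairs of level-strict matrices. -/
def levelCommuting (K : Type*) [Field K] (b : Fin n → ℕ) : Set (MatPair K n) :=
  {p ∈ levelStrict K b ×ˢ levelStrict K b | ⁅p.1, p.2⁆ = 0}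

theorem mem_levelCommuting_iff {p : MatPair K n} : p ∈ levelCommuting K b ↔
    p.1 ∈ levelStrict K b ∧ p.2 ∈ levelStrict K b ∧
      ∀ i j, b i + 2 ≤ b j → ⁅p.1, p.2⁆ i j = 0 := by
  refine ⟨fun h => ⟨h.1.1, h.1.2, fun i j _ => by rw [h.2]; rfl⟩, fun h => ⟨⟨h.1, h.2.1⟩, ?_⟩⟩
  ext i j
  rcases lt_or_ge (b j) (b i + 2) with hij | hij
  · exact lie_apply_eq_zero_of_levelStrict h.1 h.2.1 hij
  · exact h.2.2 i j hij

theorem lie_add_smul_one (A B : Matrix (Fin n) (Fin n) K) (x y : K) :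
    ⁅A + x • 1, B + y • 1⁆ = ⁅A, B⁆ := by
  simp only [Ring.lie_def, add_mul, mul_add, smul_mul_assoc, mul_smul_comm, one_mul, mul_one]
  simp only [smul_add, smul_comm y x]
  abel

/-- The diagonal entry at `o` recovers the translating scalar, so the orbit is cut out by polynomial
equations. -/
theorem mem_translationOrbit_levelCommuting_iff (o : Fin n) {q : MatPair K n} :
    q ∈ translationOrbit K n (levelCommuting K b) ↔
      (∀ i j, b j ≤ b i → (q.1 - q.1 o o • 1) i j = 0) ∧
      (∀ i j, b j ≤ b i → (q.2 - q.2 o o • 1) i j = 0) ∧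
      ∀ i j, b i + 2 ≤ b j → ⁅q.1, q.2⁆ i j = 0 := by
  constructor
  · rintro ⟨p, hp, x, y, rfl⟩
    have h1 : p.1 o o = 0 := hp.1.1 o o le_rfl
    have h2 : p.2 o o = 0 := hp.1.2 o o le_rfl
    refine ⟨fun i j hij => ?_, fun i j hij => ?_, fun i j _ => ?_⟩
    · simpa [h1] using hp.1.1 i j hij
    · simpa [h2] using hp.1.2 i j hij
    · rw [lie_add_smul_one, hp.2]; rfl
  · rintro ⟨h1, h2, h3⟩
    refine ⟨(q.1 - q.1 o o • 1, q.2 - q.2 o o • 1), mem_levelCommuting_iff.mpr ⟨h1, h2, ?_⟩,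
      q.1 o o, q.2 o o, by simp⟩
    intro i j hij
    simpa [sub_eq_add_neg, ← neg_smul, lie_add_smul_one] using h3 i j hij

theorem translationOrbit_levelCommuting_subset_CT (hb : Monotone b) :
    translationOrbit K n (levelCommuting K b) ⊆ CT K n := by
  have hu : ∀ A ∈ levelStrict K b, ∀ x : K, A + x • 1 ∈ upperTri K n := fun A hA x i j hij => by
    simp [hA i j (hb hij.le), Matrix.one_apply_ne hij.ne']
  rintro _ ⟨p, hp, x, y, rfl⟩
  exact ⟨hu _ hp.1.1 x, hu _ hp.1.2 y, by rw [lie_add_smul_one, hp.2]⟩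

theorem not_isRegularMatrix_of_mem_translationOrbit {m : ℕ} (hm : ∀ i, b i < m) (hmn : m < n)
    {q : MatPair K n} (hq : q ∈ translationOrbit K n (levelCommuting K b)) :
    ¬ IsRegularMatrix K n q.1 ∧ ¬ IsRegularMatrix K n q.2 := by
  obtain ⟨p, hp, x, y, rfl⟩ := hq
  refine ⟨not_isRegularMatrix_of_sub_smul_one_pow_eq_zero (c := x) (m := m) ?_ hmn,
    not_isRegularMatrix_of_sub_smul_one_pow_eq_zero (c := y) (m := m) ?_ hmn⟩
  · simpa using pow_eq_zero_of_levelStrict hp.1.1 hm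
  · simpa using pow_eq_zero_of_levelStrict hp.1.2 hm

open MvPolynomial

attribute [local instance] zariskiTopology pairZariski

theorem zariskiDim_levelStrict_le [Infinite K] :
    zariskiDim K n (levelStrict K b ×ˢ levelStrict K b) ≤
      ((2 * Fintype.card {e : Fin n × Fin n // b e.1 < b e.2} : ℕ) : WithBot ℕ∞) := by
  let T := {e : Fin n × Fin n // b e.1 < b e.2}
  let A : Matrix (Fin n) (Fin n) (MvPolynomial (T ⊕ T) K) :=
    Matrix.of fun i j => if h : b i < b j then X (Sum.inl ⟨(i, j), h⟩) else 0
  let B : Matrix (Fin n) (Fin n) (MvPolynomial (T ⊕ T) K) :=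
    Matrix.of fun i j => if h : b i < b j then X (Sum.inr ⟨(i, j), h⟩) else 0
  have := zariskiDim_le_card (levelStrict K b ×ˢ levelStrict K b) A B
    (Set.Subset.trans ?_ subset_closure)
  · rwa [Fintype.card_sum, ← two_mul] at this
  rintro ⟨P, Q⟩ ⟨hP, hQ⟩
  refine ⟨Sum.elim (fun e => P e.1.1 e.1.2) (fun e => Q e.1.1 e.1.2), Prod.ext ?_ ?_⟩
  · ext i j
    by_cases h : b i < b j
    · simp [A, h]
    · simpa [A, h] using (hP i j (not_lt.mp h)).symm
  · ext i j
    by_cases h : b i < b j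
    · simp [B, h]
    · simpa [B, h] using (hQ i j (not_lt.mp h)).symm

theorem le_zariskiDim_levelStrict [IsAlgClosed K] : ∃ d : ℕ,
    (d : WithBot ℕ∞) ≤ zariskiDim K n (levelStrict K b ×ˢ levelStrict K b) ∧
    2 * n ^ 2 ≤ d + 2 * (Finset.univ.filter fun e : Fin n × Fin n => b e.2 ≤ b e.1).card := by
  obtain ⟨d, W, hW, -, hl, hd⟩ := exists_strictMono_irreducibleCloseds_of_families
    (0 : MatPair K n) (Finset.univ.filter fun e : Fin n × Fin n => b e.2 ≤ b e.1)
    (Finset.univ.filter fun e : Fin n × Fin n => b e.2 ≤ b e.1) ∅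
    (fun e => genericFst K n e.1 e.2) (fun e => genericSnd K n e.1 e.2) 0
    (by simp) (by simp) (by simp)
  rw [Finset.card_empty] at hd
  refine ⟨d, le_zariskiDim_of_strictMono W hW fun q hq => ?_, by omega⟩
  have := hl q hq
  simp only [Finset.mem_filter, Finset.mem_univ, true_and, Prod.forall, eval_genericFst,
    eval_genericSnd] at this
  exact ⟨this.1, this.2.1⟩

theorem le_zariskiDim_levelCommuting [IsAlgClosed K] : ∃ d : ℕ,
    (d : WithBot ℕ∞) ≤ zariskiDim K n (levelCommuting K b) ∧
    2 * n ^ 2 ≤ d + (2 * (Finset.univ.filter fun e : Fin n × Fin n => b e.2 ≤ b e.1).card +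
      (Finset.univ.filter fun e : Fin n × Fin n => b e.1 + 2 ≤ b e.2).card) := by
  obtain ⟨d, W, hW, -, hl, hd⟩ := exists_strictMono_irreducibleCloseds_of_families
    (0 : MatPair K n) (Finset.univ.filter fun e : Fin n × Fin n => b e.2 ≤ b e.1)
    (Finset.univ.filter fun e : Fin n × Fin n => b e.2 ≤ b e.1)
    (Finset.univ.filter fun e : Fin n × Fin n => b e.1 + 2 ≤ b e.2)
    (fun e => genericFst K n e.1 e.2) (fun e => genericSnd K n e.1 e.2)
    (fun e => ⁅genericFst K n, genericSnd K n⁆ e.1 e.2)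
    (by simp) (by simp) (by simp only [eval_lie_generic]; simp [Ring.lie_def])
  refine ⟨d, le_zariskiDim_of_strictMono W hW fun q hq => ?_, by omega⟩
  have := hl q hq
  simp only [Finset.mem_filter, Finset.mem_univ, true_and, Prod.forall, eval_genericFst,
    eval_genericSnd, eval_lie_generic] at this
  exact mem_levelCommuting_iff.mpr this

/-- The equation at `(o, o)` is trivial for each matrix; dropping both gains the two dimensions of
the scalars. -/
theorem exists_strictMono_translationOrbit_levelCommuting [IsAlgClosed K] (o : Fin n) :
    ∃ (d : ℕ) (W : Fin (d + 1) → TopologicalSpace.IrreducibleCloseds (MatPair K n)),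
      StrictMono W ∧
      (W (Fin.last d) : Set (MatPair K n)) ⊆ translationOrbit K n (levelCommuting K b) ∧
      2 * n ^ 2 ≤ d +
        (2 * (Finset.univ.filter fun e : Fin n × Fin n => b e.2 ≤ b e.1 ∧ e ≠ (o, o)).card +
        (Finset.univ.filter fun e : Fin n × Fin n => b e.1 + 2 ≤ b e.2).card) := by
  obtain ⟨d, W, hW, -, hl, hd⟩ := exists_strictMono_irreducibleCloseds_of_families
    (0 : MatPair K n)
    (Finset.univ.filter fun e : Fin n × Fin n => b e.2 ≤ b e.1 ∧ e ≠ (o, o))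
    (Finset.univ.filter fun e : Fin n × Fin n => b e.2 ≤ b e.1 ∧ e ≠ (o, o))
    (Finset.univ.filter fun e : Fin n × Fin n => b e.1 + 2 ≤ b e.2)
    (fun e => (genericFst K n - genericFst K n o o • 1) e.1 e.2)
    (fun e => (genericSnd K n - genericSnd K n o o • 1) e.1 e.2)
    (fun e => ⁅genericFst K n, genericSnd K n⁆ e.1 e.2)
    (by simp) (by simp) (by simp only [eval_lie_generic]; simp [Ring.lie_def])
  refine ⟨d, W, hW, fun q hq => ?_, by omega⟩
  obtain ⟨h1, h2, h3⟩ := hl q hq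
  have e1 (i j : Fin n) : eval (pairCoords K n q)
      ((genericFst K n - genericFst K n o o • 1) i j) = (q.1 - q.1 o o • 1) i j := by
    by_cases h : i = j <;> simp [h]
  have e2 (i j : Fin n) : eval (pairCoords K n q)
      ((genericSnd K n - genericSnd K n o o • 1) i j) = (q.2 - q.2 o o • 1) i j := by
    by_cases h : i = j <;> simp [h]
  simp only [Finset.mem_filter, Finset.mem_univ, true_and, Prod.forall, eval_lie_generic,
    e1, e2] at h1 h2 h3
  rw [mem_translationOrbit_levelCommuting_iff o]
  refine ⟨fun i j hij => ?_, fun i j hij => ?_, h3⟩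
  · by_cases h : (i, j) = (o, o)
    · obtain ⟨rfl, rfl⟩ := Prod.mk.inj h
      simp
    · exact h1 i j ⟨hij, h⟩
  · by_cases h : (i, j) = (o, o)
    · obtain ⟨rfl, rfl⟩ := Prod.mk.inj h
      simp
    · exact h2 i j ⟨hij, h⟩

/-- If `CT` is irreducible, a chain of irreducible closed sets of commuting triangular pairs that
misses some pair is shorter than the dimension of `CT0`. -/
theorem succ_le_zariskiDim_CT0 [Infinite K] (hirr : ZariskiIrreducible K n (CT K n)) {d : ℕ}
    {W : Fin (d + 1) → TopologicalSpace.IrreducibleCloseds (MatPair K n)} (hW : StrictMono W)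
    {S : Set (MatPair K n)} (hWS : (W (Fin.last d) : Set (MatPair K n)) ⊆ S) (hS : S ⊂ CT K n) :
    ((d + 1 : ℕ) : WithBot ℕ∞) ≤ zariskiDim K n (CT0 K n) := by
  let Z : TopologicalSpace.IrreducibleCloseds (MatPair K n) := ⟨CT K n, hirr, isClosed_CT⟩
  have hZ : W (Fin.last d) < Z :=
    SetLike.coe_ssubset_coe.mp (lt_of_le_of_lt (show _ ⊆ S from hWS) hS)
  obtain ⟨V, hV, hVl⟩ := hW.exists_snoc hZ
  refine le_zariskiDim_of_strictMono V hV ?_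
  rw [hVl]
  exact CT_subset_CT0_of_zariskiIrreducible hirr

end BlockStrict

/-! ### The composition of 17, the threshold and the main theorem. -/

section Composition17

variable {K : Type*} [Field K]

/-- The block containing a given index, for the composition `2 + 4 + 5 + 4 + 2` of `17`. -/
def level17 : Fin 17 → ℕ := ![0, 0, 1, 1, 1, 1, 2, 2, 2, 2, 2, 3, 3, 3, 3, 4, 4]

theorem monotone_level17 : Monotone level17 := by
  rw [Fin.monotone_iff_le_succ]
  decide

theorem index_eq_level17 {J : Composition 17} (hJ : J.blocks = [2, 4, 5, 4, 2]) (i : Fin 17) :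
    (J.index i : ℕ) = level17 i := by
  have h1 := J.sizeUpTo_index_le i
  have h2 := J.lt_sizeUpTo_index_succ i
  have h3 : (J.index i : ℕ) < 5 := by
    have := (J.index i).2
    simpa [← J.blocks_length, hJ] using this
  rw [Composition.sizeUpTo, hJ] at h1 h2
  have key : ∀ i : Fin 17, ∀ k < 5, ([2, 4, 5, 4, 2].take k).sum ≤ (i : ℕ) →
      (i : ℕ) < ([2, 4, 5, 4, 2].take (k + 1)).sum → k = level17 i := by decide
  exact key i _ h3 h1 h2

theorem UJ_eq_levelStrict {J : Composition 17} (hJ : J.blocks = [2, 4, 5, 4, 2]) :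
    UJ K J = levelStrict K level17 := by
  have hi : ∀ i j, J.index i = J.index j ↔ level17 i = level17 j := fun i j => by
    rw [Fin.ext_iff, index_eq_level17 hJ, index_eq_level17 hJ]
  ext A
  constructor
  · rintro ⟨h1, h2⟩ i j hij
    rcases le_or_gt j i with h | h
    · exact h1 i j h
    · exact h2 i j ((hi i j).mpr (le_antisymm (monotone_level17 h.le) hij))
  · intro h
    exact ⟨levelStrict_subset_strictUpperTri monotone_level17 h,
      fun i j hij => h i j ((hi i j).mp hij).ge⟩

theorem NTJ_eq_levelCommuting {J : Composition 17} (hJ : J.blocks = [2, 4, 5, 4, 2]) :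
    NTJ K J = levelCommuting K level17 := by
  have hu := levelStrict_subset_strictUpperTri (K := K) monotone_level17
  ext p
  constructor
  · rintro ⟨h1, h2⟩
    rw [UJ_eq_levelStrict hJ] at h2
    exact ⟨h2, h1.1.2.2⟩
  · rintro ⟨h1, h2⟩
    refine ⟨⟨⟨fun i j hij => hu h1.1 i j hij.le, fun i j hij => hu h1.2 i j hij.le, h2⟩,
      hu h1.1, hu h1.2⟩, ?_⟩
    rwa [UJ_eq_levelStrict hJ]

theorem card_level17_le : (Finset.univ.filter fun e : Fin 17 × Fin 17 =>
    level17 e.2 ≤ level17 e.1).card = 177 := by decide +kernel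

theorem card_level17_le_ne : (Finset.univ.filter fun e : Fin 17 × Fin 17 =>
    level17 e.2 ≤ level17 e.1 ∧ e ≠ (0, 0)).card = 176 := by decide +kernel

theorem card_level17_add_two_le : (Finset.univ.filter fun e : Fin 17 × Fin 17 =>
    level17 e.1 + 2 ≤ level17 e.2).card = 56 := by decide +kernel

end Composition17

theorem exists_threshold {P : ℕ → Prop} {N : ℕ} (hP : ∀ n, 1 ≤ n → P n → P (n + 1)) (hN : P N)
    (h1 : 1 ≤ N) : ∃ m : ℕ, (∀ n : ℕ, 1 ≤ n → (P n ↔ m < n)) ∧ m < N := by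
  classical
  have hex : ∃ n, 1 ≤ n ∧ P n := ⟨N, h1, hN⟩
  have hs := Nat.find_spec hex
  refine ⟨Nat.find hex - 1, fun n hn => ⟨fun h => ?_, fun h => ?_⟩, ?_⟩
  · have := Nat.find_min' hex ⟨hn, h⟩
    omega
  · have hle : Nat.find hex ≤ n := by omega
    exact Nat.le_induction hs.2 (fun k hk hPk => hP k (hs.1.trans hk) hPk) n hle
  · have := Nat.find_min' hex ⟨h1, hN⟩
    omega

theorem mainTheorem3 (K : Type*) [Field K] [IsAlgClosed K]
    (J : Composition 17) (hJ : J.blocks = [2, 4, 5, 4, 2]) :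
    -- inside the 224-dimensional space of pairs in `UJ`, the variety `NTJ` is given by 56 equations
    zariskiDim K 17 (UJ K J ×ˢ UJ K J) = 224 ∧
    (Finset.univ.filter fun e : Fin 17 × Fin 17 =>
      (J.index e.1 : ℕ) + 2 ≤ (J.index e.2 : ℕ)).card = 56 ∧
    NTJ K J = {p ∈ UJ K J ×ˢ UJ K J | ∀ i j : Fin 17,
      (J.index i : ℕ) + 2 ≤ (J.index j : ℕ) → ⁅p.1, p.2⁆ i j = 0} ∧
    168 ≤ zariskiDim K 17 (NTJ K J) ∧
    170 ≤ zariskiDim K 17 (translationOrbit K 17 (NTJ K J)) ∧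
    zariskiDim K 17 (CT0 K 17) = 170 ∧
    -- the orbit is contained in `CT` and none of the matrices occurring in it is regular
    translationOrbit K 17 (NTJ K J) ⊆ CT K 17 ∧
    (∀ p ∈ translationOrbit K 17 (NTJ K J),
      ¬ IsRegularMatrix K 17 p.1 ∧ ¬ IsRegularMatrix K 17 p.2) ∧
    -- hence reducibility for `n = 17`, and the threshold for reducibility is less than `17`
    ¬ ZariskiIrreducible K 17 (CT K 17) ∧
    ∃ m' : ℕ, (∀ n : ℕ, 1 ≤ n → (¬ ZariskiIrreducible K n (CT K n) ↔ m' < n)) ∧ m' < 17 := by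
  have hU := UJ_eq_levelStrict (K := K) hJ
  have hN := NTJ_eq_levelCommuting (K := K) hJ
  have hm : ∀ i, level17 i < 5 := by decide
  obtain ⟨d, W, hW, hWO, hd⟩ :=
    exists_strictMono_translationOrbit_levelCommuting (K := K) (b := level17) 0
  -- The count is 2 · 17² − 2 · 176 − 56 = 170.
  rw [card_level17_le_ne, card_level17_add_two_le] at hd
  have hd : 170 ≤ d := by omega
  have hCT0 : zariskiDim K 17 (CT0 K 17) ≤ 170 := by
    have h := zariskiDim_CT0_le (K := K) (n := 17)
    have hc : Fintype.card {e : Fin 17 × Fin 17 // e.1 ≤ e.2} = 153 := by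
      rw [Fintype.card_subtype]; decide +kernel
    rw [hc] at h
    exact_mod_cast h
  have hsub := translationOrbit_levelCommuting_subset_CT (K := K) monotone_level17
  have hreg := fun q (hq : q ∈ translationOrbit K 17 (levelCommuting K level17)) =>
    not_isRegularMatrix_of_mem_translationOrbit hm (by norm_num) hq
  have hred : ¬ ZariskiIrreducible K 17 (CT K 17) := by
    intro hirr
    -- This pair has a regular first matrix, so it lies outside the orbit and the inclusion in `CT`
    -- is strict.
    obtain ⟨p, hp, h1, -⟩ := exists_mem_CT_injective_diag (K := K) (n := 17)
    have := succ_le_zariskiDim_CT0 hirr hW hWO ⟨hsub, fun h =>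
      (hreg p (h hp)).1 (isRegularMatrix_of_injective_diag hp.1 h1)⟩
    have := this.trans hCT0
    have h' : d + 1 ≤ 170 := by exact_mod_cast this
    omega
  rw [hU, hN]
  simp only [index_eq_level17 hJ]
  refine ⟨le_antisymm ?_ ?_, card_level17_add_two_le, ?_, ?_, ?_, le_antisymm hCT0 ?_, hsub, hreg,
    hred, exists_threshold (fun n _ h h' => h (zariskiIrreducible_CT_of_succ h')) hred
      (by norm_num)⟩
  · have h := zariskiDim_levelStrict_le (K := K) (b := level17)
    have hc : Fintype.card {e : Fin 17 × Fin 17 // level17 e.1 < level17 e.2} = 112 := by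
      rw [Fintype.card_subtype]; decide +kernel
    rw [hc] at h
    exact_mod_cast h
  · obtain ⟨k, hk, h⟩ := le_zariskiDim_levelStrict (K := K) (b := level17)
    rw [card_level17_le] at h
    exact le_trans (by exact_mod_cast (by omega : 224 ≤ k)) hk
  · ext p
    rw [mem_levelCommuting_iff, ← and_assoc]
    rfl
  · obtain ⟨k, hk, h⟩ := le_zariskiDim_levelCommuting (K := K) (b := level17)
    rw [card_level17_le, card_level17_add_two_le] at h
    exact le_trans (by exact_mod_cast (by omega : 168 ≤ k)) hk
  · exact le_trans (by exact_mod_cast hd) (le_zariskiDim_of_strictMono W hW hWO)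
  · obtain ⟨k, hk, h⟩ := le_zariskiDim_CT0 (K := K) (n := 17)
    have h1 : (Finset.univ.filter fun e : Fin 17 × Fin 17 => e.2 < e.1).card = 136 := by
      decide +kernel
    have h2 : (Finset.univ.filter fun e : Fin 17 × Fin 17 => e.1 < e.2).card = 136 := by
      decide +kernel
    rw [h1, h2] at h
    exact le_trans (by exact_mod_cast (by omega : 170 ≤ k)) hk
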